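/- Let $G$ be a finite connected signed plane graph (a multigraph, loops and multiple edges allowed, drawn in the plane or on the sphere, each edge carrying a sign $+$ or $-$), and let $c$ be its number of edges. Let $D$ be the non-split link diagram that $G$ represents: its projection is the medial graph of $G$, so it has one crossing on each edge of $G$, the vertices of $G$ correspond to the black regions and the faces of $G$ to the white regions of a checkerboard colouring of $D$, and the signs of the edges determine which strand passes over at each crossing. (If $G$ is a single vertex without edges, $D$ is a circle without crossings.) Let $G'$ be the dual graph of $G$, whose edges are identified with those of $G$. For a graph $H$ let $M(H)$ be its incidence matrix: rows are indexed by the vertices $x$, columns by the edges $y$, and the entry is $1$ if $y$ is incident with $x$ (also if $y$ is a loop at $x$) and $0$ otherwise. Let $$M(D)=\begin{bmatrix} M(G)\\ M(G')\end{bmatrix},$$ a $(c+2)\times c$ matrix over $\mathbb{Z}_2$ whose rows correspond to the regions of $D$ and whose columns correspond to its crossings. Then, for every integer $n\ge 0$, the diagram $D$ has exactly $n$ components if and only if the $\mathbb{Z}_2$-rank of $M(D)$ equals $c-n+1$. -/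

import Mathlib

/-! ## Graphs drawn on closed oriented surfaces

A finite multigraph (loops and multiple edges allowed) with vertex set `V` and edge set `E`.
An edge `e` has the two half-edges `(e, false)` and `(e, true)`; exchanging them is `twin`.
A drawing on an oriented surface is recorded by its rotation system: the permutation `rot` sends a
half-edge to the next half-edge, counterclockwise, around the vertex it emanates from. -/

/-- The other half of the same edge. -/
def twin {E : Type*} : Equiv.Perm (E × Bool) where
  toFun h := (h.1, !h.2)
  invFun h := (h.1, !h.2)
  left_inv _ := by simp
  right_inv _ := by simp

/-- A multigraph with a rotation system (a combinatorial map). A vertex without half-edges is an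
isolated vertex. -/
structure EmbeddedGraph (V E : Type*) where
  /-- the vertex a half-edge emanates from -/
  vert : E × Bool → V
  /-- the counterclockwise rotation about the vertices -/
  rot : Equiv.Perm (E × Bool)
  /-- the half-edges at a vertex form exactly one cycle of `rot` -/
  sameCycle_iff : ∀ h k, rot.SameCycle h k ↔ vert h = vert k

namespace EmbeddedGraph

variable {V E : Type*} (G : EmbeddedGraph V E)

/-- The face permutation. Walk along the half-edge `h` to the other end of its edge and take the
next half-edge clockwise there: this follows the boundary of the face to the left of `h`. -/
def facePerm : Equiv.Perm (E × Bool) := G.rot⁻¹ * twin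

/-- The vertices without half-edges. -/
abbrev Isolated : Type _ := {v : V // ∀ h, G.vert h ≠ v}

/-- The faces of a (connected) graph: one for each boundary walk, that is, for each cycle of the
face permutation; an isolated vertex has the trivial boundary walk, so that the graph with one
vertex and no edge has one face. -/
abbrev Face : Type _ := Quotient (Equiv.Perm.SameCycle.setoid G.facePerm) ⊕ G.Isolated

/-- The dual graph: its vertices are the faces of `G`, its edges are the edges of `G`, and the
dual half-edge `h` emanates from the face to the left of `h`. -/
def dual : EmbeddedGraph G.Face E where
  vert h := Sum.inl (Quotient.mk (Equiv.Perm.SameCycle.setoid G.facePerm) h)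
  rot := G.facePerm
  sameCycle_iff h k := by
    rw [Sum.inl.injEq]
    exact (Quotient.eq (r := Equiv.Perm.SameCycle.setoid G.facePerm)).symm

/-- Two vertices are joined if they are the ends of an edge. -/
def Joined (x y : V) : Prop := ∃ h, G.vert h = x ∧ G.vert (twin h) = y

/-- The graph is non-empty and connected. -/
def Connected : Prop := (SimpleGraph.fromRel G.Joined).Connected

/-- A connected graph drawn on the sphere, that is, on the closed oriented surface with
`v - e + f = 2`: a connected plane graph. -/
def IsPlane : Prop :=
  G.Connected ∧ Nat.card V + Nat.card G.Face = Nat.card E + 2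

open Classical in
/-- The incidence matrix over the field with two elements: the entry at `(x, e)` is `1` if the edge
`e` is incident with the vertex `x` (also if `e` is a loop at `x`), and `0` otherwise. -/
noncomputable def incidence : Matrix V E (ZMod 2) :=
  Matrix.of fun x e => if ∃ s, G.vert (e, s) = x then 1 else 0

end EmbeddedGraph

/-! ## Link diagrams -/

/-- A non-split link diagram with set of crossings `X` and set of arcs `A`. Its projection is a
connected plane graph with a vertex of degree 4 at each crossing, whose edges are the arcs between
crossings; the one exception is a diagram without crossings, which is a single circle. -/
structure LinkDiagram (X A : Type*) [Finite X] [Finite A] where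
  /-- the projection of the components that meet a crossing -/
  proj : EmbeddedGraph X A
  /-- the number of components without crossings -/
  circles : ℕ
  fourValent : ∀ x, Nat.card {h // proj.vert h = x} = 4
  nonsplit : (circles = 0 ∧ proj.IsPlane) ∨ (circles = 1 ∧ IsEmpty X)
  /-- whether a half-arc belongs to the overpassing strand of the crossing it emanates from -/
  isOver : A × Bool → Bool
  /-- opposite half-arcs form a strand, and one of the two strands is above the other -/
  isOver_rot : ∀ h, isOver (proj.rot h) = !(isOver h)

namespace LinkDiagram

variable {X A : Type*} [Finite X] [Finite A] (D : LinkDiagram X A)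

/-- Two arcs follow each other on the link: they contain opposite half-arcs at a crossing. -/
def Follows (a b : A) : Prop := ∃ h, h.1 = a ∧ (D.proj.rot (D.proj.rot h)).1 = b

/-- The number of components of the link: the classes of arcs that are connected by passing
straight through crossings, and the circles without crossings. -/
noncomputable def numComponents : ℕ := Nat.card (Quot D.Follows) + D.circles

end LinkDiagram

/-! ## Signed plane graphs and the diagrams they represent -/

/-- A connected signed plane graph. -/
structure SignedPlaneGraph (V E : Type*) [Finite V] [Finite E] extends EmbeddedGraph V E where
  isPlane : toEmbeddedGraph.IsPlane
  sign : E → ℤˣ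

namespace EmbeddedGraph

variable {V E : Type*} (G : EmbeddedGraph V E)

/-- The rotation of the medial graph; see `medial`. -/
def medialRot : Equiv.Perm ((E × Bool) × Bool) where
  toFun h := if h.2 then (twin (G.rot h.1), false) else (G.rot⁻¹ h.1, true)
  invFun h := if h.2 then (G.rot h.1, false) else (G.rot⁻¹ (twin h.1), true)
  left_inv := by rintro ⟨⟨e, s⟩, _ | _⟩ <;> simp [twin]
  right_inv := by rintro ⟨⟨e, s⟩, _ | _⟩ <;> simp [twin]

/-- The end of a medial half-arc; see `medial`. -/
def medialVert (h : (E × Bool) × Bool) : E := if h.2 then (G.rot h.1).1 else h.1.1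

theorem medialVert_rot (h : (E × Bool) × Bool) :
    G.medialVert (G.medialRot h) = G.medialVert h := by
  obtain ⟨⟨e, s⟩, _ | _⟩ := h <;> simp [medialVert, medialRot, twin]

theorem medial_sameCycle_iff (h k : (E × Bool) × Bool) :
    G.medialRot.SameCycle h k ↔ G.medialVert h = G.medialVert k := by
  have step : ∀ h, G.medialRot.SameCycle h (G.medialRot h) := fun h =>
    Equiv.Perm.sameCycle_apply_right.2 (Equiv.Perm.SameCycle.refl _ _)
  constructor
  · rintro ⟨i, rfl⟩
    induction i with
    | zero => simp
    | succ i ih => rw [add_comm, zpow_add, Equiv.Perm.mul_apply, zpow_one, medialVert_rot, ih]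
    | pred i ih =>
      rw [ih, ← G.medialVert_rot ((G.medialRot ^ (-(i : ℤ) - 1)) h), ← Equiv.Perm.mul_apply,
        ← zpow_one_add]
      congr 2; ring_nf
  · have half : ∀ a : E × Bool, G.medialRot.SameCycle (a, false) (twin a, false) := fun a => by
      have h1 := step (a, false)
      have h2 := h1.trans (step _)
      simpa [medialRot] using h2
    have base : ∀ h, G.medialRot.SameCycle ((G.medialVert h, false), false) h := by
      have b0 : ∀ e s, G.medialRot.SameCycle ((e, false), false) ((e, s), false) := by
        intro e s
        cases s
        · exact Equiv.Perm.SameCycle.refl _ _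
        · simpa [twin] using half (e, false)
      rintro ⟨a, _ | _⟩
      · exact b0 _ _
      · refine (b0 _ (G.rot a).2).trans ?_
        have := step (G.rot a, false)
        simpa [medialRot, medialVert] using this
    intro hk
    exact (base h).symm.trans (hk ▸ base k)

/-- The medial graph. It has a vertex on each edge of `G` and an edge in each corner of `G`. The
corner between the half-edges `a` and `G.rot a` is called `a`; the edge of the medial graph in it
has the half `(a, false)` that emanates from the midpoint of the edge of `a`, and the half
`(a, true)` that emanates from the midpoint of the edge of `G.rot a`. Seen along the half-edge `a`,
the midpoint of the edge of `a` has, counterclockwise, the half-edges `(a, false)` (left of `a`, in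
the backward direction), `(G.rot⁻¹ a, true)` (right of `a`, backward), `(twin a, false)` (right of
`a`, forward) and `(G.rot⁻¹ (twin a), true)` (left of `a`, forward). -/
def medial : EmbeddedGraph E (E × Bool) where
  vert := G.medialVert
  rot := G.medialRot
  sameCycle_iff := G.medial_sameCycle_iff

theorem medial_fourValent (e : E) : Nat.card {h // G.medial.vert h = e} = 4 := by
  have : {h // G.medial.vert h = e} ≃ Bool × Bool :=
    { toFun := fun h => if h.1.2 then ((G.rot h.1.1).2, true) else (h.1.1.2, false)
      invFun := fun p => if p.2 then ⟨(G.rot⁻¹ (e, p.1), true), by simp [medial, medialVert]⟩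
        else ⟨((e, p.1), false), by simp [medial, medialVert]⟩
      left_inv := by
        rintro ⟨⟨a, _ | _⟩, rfl⟩ <;> simp [medial, medialVert]
      right_inv := by rintro ⟨s, _ | _⟩ <;> simp }
  rw [Nat.card_congr this]
  simp

theorem joined_reachable {x y : V} (h : G.Joined x y) :
    (SimpleGraph.fromRel G.Joined).Reachable x y := by
  by_cases hxy : x = y
  · exact hxy ▸ SimpleGraph.Reachable.refl _
  · exact SimpleGraph.Adj.reachable ((SimpleGraph.fromRel_adj _ _ _).2 ⟨hxy, Or.inl h⟩)

theorem medial_rot_reachable (h : E × Bool) :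
    (SimpleGraph.fromRel G.medial.Joined).Reachable h.1 (G.rot h).1 := by
  apply joined_reachable
  exact ⟨(h, false), by simp [medial, medialVert], by simp [medial, medialVert, twin]⟩

theorem medial_vert_reachable {h k : E × Bool} (hk : G.vert h = G.vert k) :
    (SimpleGraph.fromRel G.medial.Joined).Reachable h.1 k.1 := by
  obtain ⟨i, rfl⟩ := (G.sameCycle_iff h k).2 hk
  clear hk
  induction i with
  | zero => exact SimpleGraph.Reachable.refl _
  | succ i ih =>
    refine ih.trans ?_
    rw [add_comm, zpow_add, Equiv.Perm.mul_apply, zpow_one]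
    exact G.medial_rot_reachable _
  | pred i ih =>
    refine ih.trans (SimpleGraph.Reachable.symm ?_)
    have := G.medial_rot_reachable ((G.rot ^ (-(i : ℤ) - 1)) h)
    rw [← Equiv.Perm.mul_apply, ← zpow_one_add] at this
    convert this using 5
    ring

theorem medial_connected [Nonempty E] (hG : G.Connected) : G.medial.Connected := by
  have key : ∀ x y, (SimpleGraph.fromRel G.Joined).Walk x y → ∀ h k, G.vert h = x → G.vert k = y →
      (SimpleGraph.fromRel G.medial.Joined).Reachable h.1 k.1 := by
    intro x y w
    induction w with
    | nil => intro h k hh hk; exact G.medial_vert_reachable (hh.trans hk.symm)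
    | cons hadj _ ih =>
      intro h k hh hk
      obtain ⟨-, ⟨l, hl1, hl2⟩ | ⟨l, hl1, hl2⟩⟩ := (SimpleGraph.fromRel_adj _ _ _).1 hadj
      · exact (G.medial_vert_reachable (hh.trans hl1.symm)).trans (ih (twin l) k hl2 hk)
      · exact (G.medial_vert_reachable (hh.trans hl2.symm)).trans (ih l k hl1 hk)
  refine (SimpleGraph.connected_iff _).2 ⟨fun e f => ?_, inferInstance⟩
  obtain ⟨w⟩ := hG.preconnected (G.vert (e, false)) (G.vert (f, false))
  exact key _ _ w (e, false) (f, false) rfl rfl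

theorem vert_surjective [Nonempty E] (hG : G.Connected) : Function.Surjective G.vert := by
  intro v
  by_contra hv
  push Not at hv
  obtain ⟨e⟩ := ‹Nonempty E›
  obtain ⟨w⟩ := hG.preconnected v (G.vert (e, false))
  cases w with
  | nil => exact hv _ rfl
  | cons hadj _ =>
    obtain ⟨-, ⟨l, hl1, hl2⟩ | ⟨l, hl1, hl2⟩⟩ := (SimpleGraph.fromRel_adj _ _ _).1 hadj
    · exact hv _ hl1
    · exact hv _ hl2

theorem medial_facePerm_false (a : E × Bool) :
    G.medial.facePerm (a, false) = (G.rot a, false) := by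
  change G.medialRot.symm (a, true) = _
  rfl

theorem medial_facePerm_true (a : E × Bool) :
    G.medial.facePerm (a, true) = (G.facePerm a, true) := by
  change G.medialRot.symm (a, false) = _
  rfl

theorem medial_facePerm_zpow_false (a : E × Bool) (i : ℤ) :
    (G.medial.facePerm ^ i) (a, false) = ((G.rot ^ i) a, false) := by
  induction i with
  | zero => rfl
  | succ i ih =>
    rw [add_comm, zpow_add, zpow_add, Equiv.Perm.mul_apply, Equiv.Perm.mul_apply, ih]
    exact G.medial_facePerm_false _
  | pred i ih =>
    apply G.medial.facePerm.injective
    rw [G.medial_facePerm_false, ← Equiv.Perm.mul_apply, ← Equiv.Perm.mul_apply, ← zpow_one_add,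
      ← zpow_one_add, add_sub_cancel, ih]

theorem medial_facePerm_zpow_true (a : E × Bool) (i : ℤ) :
    (G.medial.facePerm ^ i) (a, true) = ((G.facePerm ^ i) a, true) := by
  induction i with
  | zero => rfl
  | succ i ih =>
    rw [add_comm, zpow_add, zpow_add, Equiv.Perm.mul_apply, Equiv.Perm.mul_apply, ih]
    exact G.medial_facePerm_true _
  | pred i ih =>
    apply G.medial.facePerm.injective
    rw [G.medial_facePerm_true, ← Equiv.Perm.mul_apply, ← Equiv.Perm.mul_apply, ← zpow_one_add,
      ← zpow_one_add, add_sub_cancel, ih]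

/-- The faces of the medial graph are the vertices and the faces of `G`. -/
theorem medial_card_face [Finite V] [Finite E] [Nonempty E] (hG : G.Connected) :
    Nat.card G.medial.Face = Nat.card V + Nat.card G.Face := by
  have hI : IsEmpty G.Isolated := ⟨fun v => by
    obtain ⟨h, hh⟩ := G.vert_surjective hG v.1
    exact v.2 h hh⟩
  have hI' : IsEmpty G.medial.Isolated := ⟨fun v => v.2 ((v.1, false), false) rfl⟩
  have e1 : G.medial.Face ≃ Quotient (Equiv.Perm.SameCycle.setoid G.medial.facePerm) :=
    Equiv.sumEmpty _ _
  have e2 : G.Face ≃ Quotient (Equiv.Perm.SameCycle.setoid G.facePerm) := Equiv.sumEmpty _ _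
  have : Finite (Quotient (Equiv.Perm.SameCycle.setoid G.facePerm)) := Quotient.finite _
  rw [Nat.card_congr e1, Nat.card_congr e2, ← Nat.card_sum]
  refine Nat.card_congr (Equiv.ofBijective (Quotient.lift
    (fun h : (E × Bool) × Bool => if h.2 then
      Sum.inr (Quotient.mk (Equiv.Perm.SameCycle.setoid G.facePerm) h.1)
      else Sum.inl (G.vert h.1)) ?_) ⟨?_, ?_⟩)
  · rintro ⟨a, _ | _⟩ k ⟨i, rfl⟩
    · rw [medial_facePerm_zpow_false]
      simpa using (G.sameCycle_iff _ _).1 ⟨i, rfl⟩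
    · rw [medial_facePerm_zpow_true]
      simpa using Quotient.sound (s := Equiv.Perm.SameCycle.setoid G.facePerm) ⟨i, rfl⟩
  · rintro ⟨a, _ | _⟩ ⟨b, _ | _⟩ h
    · obtain ⟨i, rfl⟩ := (G.sameCycle_iff a b).2 (Sum.inl_injective h)
      exact Quotient.sound (s := Equiv.Perm.SameCycle.setoid G.medial.facePerm)
        ⟨i, medial_facePerm_zpow_false _ _ _⟩
    · exact absurd h Sum.inl_ne_inr
    · exact absurd h Sum.inr_ne_inl
    · have h' : Quotient.mk (Equiv.Perm.SameCycle.setoid G.facePerm) a =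
          Quotient.mk (Equiv.Perm.SameCycle.setoid G.facePerm) b := Sum.inr_injective h
      obtain ⟨i, rfl⟩ := Quotient.exact h'
      exact Quotient.sound (s := Equiv.Perm.SameCycle.setoid G.medial.facePerm)
        ⟨i, medial_facePerm_zpow_true _ _ _⟩
  · rintro (v | q)
    · obtain ⟨h, rfl⟩ := G.vert_surjective hG v
      exact ⟨Quotient.mk _ (h, false), rfl⟩
    · induction q using Quotient.inductionOn with
      | h a => exact ⟨Quotient.mk _ (a, true), rfl⟩

theorem medial_isPlane [Finite V] [Finite E] [Nonempty E] (hG : G.IsPlane) :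
    G.medial.IsPlane := by
  refine ⟨G.medial_connected hG.1, ?_⟩
  rw [G.medial_card_face hG.1, hG.2, Nat.card_prod]
  simp
  ring

theorem card_isolated_of_nonempty [Nonempty E] (hG : G.Connected) :
    Nat.card G.Isolated = 0 := by
  have : IsEmpty G.Isolated := ⟨fun v => by
    obtain ⟨h, hh⟩ := G.vert_surjective hG v.1
    exact v.2 h hh⟩
  exact Nat.card_of_isEmpty

theorem card_isolated_of_isEmpty [IsEmpty E] (hG : G.Connected) :
    Nat.card G.Isolated = 1 := by
  obtain ⟨v⟩ := hG.nonempty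
  rw [Nat.card_eq_one_iff_unique]
  refine ⟨⟨fun ⟨x, _⟩ ⟨y, _⟩ => Subtype.ext ?_⟩, ⟨⟨v, fun h => isEmptyElim h⟩⟩⟩
  obtain ⟨w⟩ := hG.preconnected x y
  cases w with
  | nil => rfl
  | cons hadj _ =>
    obtain ⟨-, ⟨l, -⟩ | ⟨l, -⟩⟩ := (SimpleGraph.fromRel_adj _ _ _).1 hadj <;> exact isEmptyElim l

end EmbeddedGraph

namespace SignedPlaneGraph

variable {V E : Type*} [Finite V] [Finite E] (G : SignedPlaneGraph V E)

/-- The link diagram represented by a signed plane graph. Its projection is the medial graph: there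
is a crossing on each edge of `G`, and the regions that contain the vertices of `G` are the black
regions of a checkerboard colouring. On a positive edge the overpassing strand sweeps the two black
regions at the crossing when it is turned counterclockwise, and on a negative edge it sweeps the two
white ones. The graph with one vertex and no edge represents a circle around its vertex. -/
noncomputable def diagram : LinkDiagram E (E × Bool) where
  proj := G.medial
  circles := Nat.card G.Isolated
  fourValent := G.medial_fourValent
  nonsplit := by
    rcases isEmpty_or_nonempty E with h | h
    · exact Or.inr ⟨G.card_isolated_of_isEmpty G.isPlane.1, h⟩
    · exact Or.inl ⟨G.card_isolated_of_nonempty G.isPlane.1, G.medial_isPlane G.isPlane⟩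
  isOver h := if h.2 then decide (G.sign (G.rot h.1).1 = -1) else decide (G.sign h.1.1 = 1)
  isOver_rot := by
    have hs : ∀ s : ℤˣ, decide (s = -1) = !decide (s = 1) := by decide
    rintro ⟨⟨e, s⟩, _ | _⟩ <;>
      simp [EmbeddedGraph.medial, EmbeddedGraph.medialRot, twin, hs]

/-- The matrix with the rows of the incidence matrix of `G`, followed by those of the incidence
matrix of the dual graph. Its rows correspond to the regions of the diagram, and its columns to the
crossings. -/
noncomputable def regionMatrix : Matrix (V ⊕ G.Face) E (ZMod 2) :=
  Matrix.fromRows G.incidence G.dual.incidence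

end SignedPlaneGraph

/-! Call a vector on the edges a bicycle if it is the mod 2 coboundary of a function on the vertices
and also of a function on the faces. The dimension of the space of bicycles is computed in two ways.

Components: colour the `n` components with elements of `ZMod 2` and mark the crossings where
different colours meet. If there are edges, connectedness implies that only the constant colourings
mark nothing, and the marked sets are exactly the bicycles (`range_crossingMap`). Indeed, if `x` is
the coboundary of both `a` and `b`, give the arc in the corner of a vertex `v` and a face `f` the
colour `a v + b f`; passing straight through a crossing changes both terms by the value of `x`
there. So the dimension is `n - 1`. The signs play no role.

Matrix: by Euler's formula the coboundaries of vertex functions and those of face functions form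
orthogonal complements. Without loops in the graph or its dual, the kernel of the matrix would
therefore visibly be the bicycle space. A loop, however, has entry 1 where the mod 2 boundary has 0,
and this adds a term to the kernel equations. A vector in both kernels nevertheless vanishes on the
loops of the graph and of its dual (`eq_zero_of_loop`), by induction over nested separations of the
sphere. So the kernel is the bicycle space (`ker_regionMatrix`), and the rank is `c - (n - 1)`. -/

/-! ## Linear algebra -/

/-- The orthogonal complement of `W` contains `U` and has the same dimension, so it equals `U`. -/
theorem mem_of_dotProduct_eq_zero {K ι : Type*} [Field K] [Fintype ι]
    {U W : Submodule K (ι → K)} (hUW : ∀ u ∈ U, ∀ w ∈ W, u ⬝ᵥ w = 0)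
    (hdim : Module.finrank K U + Module.finrank K W = Fintype.card ι)
    {x : ι → K} (hx : ∀ w ∈ W, x ⬝ᵥ w = 0) : x ∈ U := by
  classical
  let W' : Submodule K (ι → K) :=
    W.dualAnnihilator.comap (dotProductEquiv K ι : (ι → K) →ₗ[K] Module.Dual K (ι → K))
  have mem : ∀ y, y ∈ W' ↔ ∀ w ∈ W, y ⬝ᵥ w = 0 := fun y => by
    simp [W', Submodule.mem_dualAnnihilator]
  have h1 : Module.finrank K W' = Module.finrank K W.dualAnnihilator :=
    (LinearEquiv.ofSubmodule' (dotProductEquiv K ι) W.dualAnnihilator).finrank_eq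
  have h2 := Subspace.finrank_add_finrank_dualAnnihilator_eq W
  rw [Module.finrank_fintype_fun_eq_card] at h2
  have h3 : U = W' := Submodule.eq_of_le_of_finrank_eq
    (fun u hu => (mem u).2 (hUW u hu)) (by omega)
  rw [h3]
  exact (mem x).2 hx

theorem finrank_range_add_one {K W M : Type*} [Field K] [Fintype W] [Nonempty W]
    [AddCommGroup M] [Module K M] (T : (W → K) →ₗ[K] M)
    (hT : ∀ a, T a = 0 ↔ ∀ v w, a v = a w) :
    Module.finrank K (LinearMap.range T) + 1 = Fintype.card W := by
  have hker : LinearMap.ker T = K ∙ (1 : W → K) := by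
    ext a
    rw [LinearMap.mem_ker, hT, Submodule.mem_span_singleton]
    constructor
    · intro h
      obtain ⟨w⟩ := ‹Nonempty W›
      exact ⟨a w, by ext v; simp [h v w]⟩
    · rintro ⟨c, rfl⟩ v w
      simp
  have h := T.finrank_range_add_finrank_ker
  rwa [hker, finrank_span_singleton one_ne_zero, Module.finrank_fintype_fun_eq_card] at h

theorem ZMod.two_eq_zero_or_one (z : ZMod 2) : z = 0 ∨ z = 1 := by
  revert z; decide

/-! ## Coboundaries -/

/-- The coboundary of a function on the vertices of a graph, where `u` sends a half-edge to the
vertex it emanates from. -/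
def coboundary {W E : Type*} (u : E × Bool → W) : (W → ZMod 2) →ₗ[ZMod 2] (E → ZMod 2) where
  toFun a e := a (u (e, false)) + a (u (e, true))
  map_add' a b := by ext e; simp only [Pi.add_apply]; ring
  map_smul' c a := by ext e; simp [mul_add]

section Coboundary

variable {V F E : Type*}

theorem coboundary_apply (u : E × Bool → V) (a : V → ZMod 2) (h : E × Bool) :
    coboundary u a h.1 = a (u h) + a (u (twin h)) := by
  obtain ⟨e, _ | _⟩ := h
  · rfl
  · exact add_comm _ _

theorem coboundary_of_const (u : E × Bool → V) {a : V → ZMod 2} (ha : ∀ v w, a v = a w) :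
    coboundary u a = 0 := by
  ext e
  exact CharTwo.add_eq_zero.2 (ha _ _)

theorem coboundary_of_loop {u : E × Bool → V} {e : E} (he : u (e, false) = u (e, true))
    (a : V → ZMod 2) : coboundary u a e = 0 :=
  CharTwo.add_eq_zero.2 (congrArg a he)

theorem dotProduct_coboundary [Fintype E] (u : E × Bool → V) (x : E → ZMod 2) (a : V → ZMod 2) :
    x ⬝ᵥ coboundary u a = ∑ h : E × Bool, x h.1 * a (u h) := by
  rw [Fintype.sum_prod_type]
  refine Finset.sum_congr rfl fun e _ => ?_
  rw [Fintype.sum_bool, ← mul_add, add_comm]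
  rfl

/-! ### Nested separations of the sphere by loops and dual loops -/

/-- A half-edge is separated from the half-edges `k` with `g k = 0` if it is separated by a
separation nested in that of `g`. -/
theorem separation_nested {H : Type*} (σ φ : Equiv.Perm H)
    (trans : ∀ p : H → ZMod 2, (∀ h, p (σ h) = p h) → (∀ h, p (φ h) = p h) → ∀ h k, p h = p k)
    {f g : H → ZMod 2} {P Q : H → Prop} {c : ZMod 2} {h₀ : H}
    (hfσ : ∀ h, f (σ h) = f h) (hgφ : ∀ h, g (φ h) = g h)
    (hfφ : ∀ h, ¬ P h → f (φ h) = f h) (hgσ : ∀ h, ¬ Q h → g (σ h) = g h)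
    (hP : ∀ h, P h → g h = 1) (hQ : ∀ h, Q h → f h = c) (hQ' : ∃ h, Q h)
    (hf₀ : f h₀ = 0) (hg₀ : g h₀ = 0) (h : H) (hh : f h = 1) : g h = 1 := by
  -- The product is invariant under both permutations. Where `f` may jump, the second factor is 0
  -- before and after the jump; where `g` may jump, the first factor is.
  have key : ∀ h k, (f h + c) * (1 + g h) = (f k + c) * (1 + g k) := by
    refine trans (fun h => (f h + c) * (1 + g h)) (fun h => ?_) (fun h => ?_)
    · by_cases hq : Q h
      · have hcc : c + c = 0 := CharTwo.add_eq_zero.2 rfl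
        simp only [hfσ, hQ h hq, hcc, zero_mul]
      · simp only [hfσ, hgσ h hq]
    · by_cases hp : P h
      · have h2 : (1 + 1 : ZMod 2) = 0 := by decide
        simp only [hgφ, hP h hp, h2, mul_zero]
      · simp only [hgφ, hfφ h hp]
  obtain ⟨k, hk⟩ := hQ'
  -- The constant value of the product is 0 at a point of `Q` and `c` at `h₀`. Hence `c = 0`, and `f
  -- h = 1` forces `g h = 1`.
  have h1 := key k h₀
  have h2 := key h h₀
  rw [hQ k hk, hf₀, hg₀] at h1
  rw [hf₀, hg₀, hh] at h2
  clear key hQ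
  revert h1 h2
  generalize g h = y
  generalize g k = z
  revert c y z
  decide

/-- Suppose that `b` separates the faces along the loop `e` of a graph, and `a` separates the
vertices along the loop `e'` of its dual, and `e'` lies on the side of `e` that does not contain the
corner `h₀`. Then that side contains the side of `e'` that does not contain `h₀`. -/
theorem card_separation_lt [Fintype E] [DecidableEq E] {vert : E × Bool → V} {face : E × Bool → F}
    {σ φ : Equiv.Perm (E × Bool)} {p q : E × Bool → E}
    (trans : ∀ p : E × Bool → ZMod 2, (∀ h, p (σ h) = p h) → (∀ h, p (φ h) = p h) →
      ∀ h k, p h = p k)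
    (vσ : ∀ h, vert (σ h) = vert h) (fφ : ∀ h, face (φ h) = face h)
    (hp : ∀ a h, coboundary vert a (p h) = a (vert h) + a (vert (φ h)))
    (hq : ∀ b h, coboundary face b (q h) = b (face h) + b (face (σ h)))
    (pface : ∀ h, ∃ s, face h = face (p h, s)) (qvert : ∀ h, ∃ s, vert h = vert (q h, s))
    (qsurj : Function.Surjective q) {h₀ : E × Bool} {e e' : E} {a : V → ZMod 2} {b : F → ZMod 2}
    (he : vert (e, false) = vert (e, true)) (he' : face (e', false) = face (e', true))
    (ha : coboundary vert a = Pi.single e' 1) (hb : coboundary face b = Pi.single e 1)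
    (ha₀ : a (vert h₀) = 0) (hb₀ : b (face h₀) = 0) (hbe' : b (face (e', false)) = 1) :
    (Finset.univ.filter fun h => a (vert h) = 1).card <
      (Finset.univ.filter fun h => b (face h) = 1).card := by
  have hbe : ∀ s, b (face (e', s)) = 1 := by
    rintro (_ | _)
    · exact hbe'
    · rwa [← he']
  have hae : ∀ s, a (vert (e, s)) = a (vert (e, false)) := by
    rintro (_ | _)
    · rfl
    · rw [he]
  apply Finset.card_lt_card
  rw [Finset.ssubset_iff_of_subset]
  -- Strictness: both halves of `e'` lie in the larger set, but `a` takes different values at them.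
  · have h1 := congrFun ha e'
    rw [Pi.single_eq_same] at h1
    change a (vert (e', false)) + a (vert (e', true)) = 1 at h1
    by_cases h2 : a (vert (e', false)) = 1
    · refine ⟨(e', true), by simp [hbe], ?_⟩
      rw [h2] at h1
      simpa using fun h => by simp [h] at h1
    · exact ⟨(e', false), by simp [hbe], by simp [h2]⟩
  · intro h hh
    simp only [Finset.mem_filter, Finset.mem_univ, true_and] at hh ⊢
    refine separation_nested σ φ trans (f := fun h => a (vert h)) (g := fun h => b (face h))
      (P := fun h => p h = e') (Q := fun h => q h = e) (c := a (vert (e, false))) (h₀ := h₀)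
      (fun h => by simp only [vσ]) (fun h => by simp only [fφ]) (fun h hh => ?_) (fun h hh => ?_)
      (fun h hh => ?_) (fun h hh => ?_) (qsurj e) ha₀ hb₀ h hh
    · have := hp a h
      rw [ha, Pi.single_eq_of_ne hh] at this
      exact (CharTwo.add_eq_zero.1 this.symm).symm
    · have := hq b h
      rw [hb, Pi.single_eq_of_ne hh] at this
      exact (CharTwo.add_eq_zero.1 this.symm).symm
    · obtain ⟨s, hs⟩ := pface h
      change p h = e' at hh
      rw [hs, hh, hbe]
    · obtain ⟨s, hs⟩ := qvert h
      change q h = e at hh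
      rw [hs, hh, hae]

open Classical in
-- Testing the kernel equation on the side `b` of the loop `e` gives `x e` plus the sum of `x e'`
-- over the dual loops `e'` on that side. Each such `e'` cuts off a strictly smaller side, so the
-- induction hypothesis removes it. The data `vert`, `face`, `σ`, `φ`, `p`, `q` are abstract so that
-- the same step serves the graph and its dual.
theorem eq_zero_of_loop_step [Fintype E] {vert : E × Bool → V} {face : E × Bool → F}
    {σ φ : Equiv.Perm (E × Bool)} {p q : E × Bool → E}
    (trans : ∀ p : E × Bool → ZMod 2, (∀ h, p (σ h) = p h) → (∀ h, p (φ h) = p h) →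
      ∀ h k, p h = p k)
    (vσ : ∀ h, vert (σ h) = vert h) (fφ : ∀ h, face (φ h) = face h)
    (hp : ∀ a h, coboundary vert a (p h) = a (vert h) + a (vert (φ h)))
    (hq : ∀ b h, coboundary face b (q h) = b (face h) + b (face (σ h)))
    (pface : ∀ h, ∃ s, face h = face (p h, s)) (qvert : ∀ h, ∃ s, vert h = vert (q h, s))
    (qsurj : Function.Surjective q) {h₀ : E × Bool} {x : E → ZMod 2}
    (hx : ∀ b : F → ZMod 2, x ⬝ᵥ coboundary face b +
      ∑ e, (if face (e, false) = face (e, true) then x e * b (face (e, false)) else 0) = 0)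
    (ex : ∀ e, face (e, false) = face (e, true) →
      ∃ a, coboundary vert a = Pi.single e 1 ∧ a (vert h₀) = 0) {n : ℕ}
    (ih : ∀ (e : E) (a : V → ZMod 2), face (e, false) = face (e, true) →
      coboundary vert a = Pi.single e 1 → a (vert h₀) = 0 →
      (Finset.univ.filter fun h => a (vert h) = 1).card < n → x e = 0)
    {e : E} {b : F → ZMod 2} (he : vert (e, false) = vert (e, true))
    (hb : coboundary face b = Pi.single e 1) (hb₀ : b (face h₀) = 0)
    (hn : (Finset.univ.filter fun h => b (face h) = 1).card < n + 1) : x e = 0 := by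
  have h1 := hx b
  rw [Finset.sum_eq_zero, add_zero, hb, dotProduct_single, mul_one] at h1
  · exact h1
  · intro e' _
    split_ifs with he'
    · obtain hbe' | hbe' := ZMod.two_eq_zero_or_one (b (face (e', false)))
      · rw [hbe', mul_zero]
      · obtain ⟨a, ha, ha₀⟩ := ex e' he'
        have := card_separation_lt trans vσ fφ hp hq pface qvert qsurj he he' ha hb ha₀ hb₀ hbe'
        rw [ih e' a he' ha ha₀ (by omega), zero_mul]
    · rfl

end Coboundary

/-! ### Cuts of an embedded graph and of its dual -/

namespace EmbeddedGraph

variable {V E : Type*} (G : EmbeddedGraph V E)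

theorem vert_rot (h : E × Bool) : G.vert (G.rot h) = G.vert h :=
  ((G.sameCycle_iff _ _).1 (Equiv.Perm.sameCycle_apply_right.2 (.refl _ _))).symm

theorem inv_rot_rot (h : E × Bool) : G.rot⁻¹ (G.rot h) = h :=
  G.rot.symm_apply_apply h

theorem rot_inv_rot (h : E × Bool) : G.rot (G.rot⁻¹ h) = h :=
  G.rot.apply_symm_apply h

/-- The face to the left of a half-edge. -/
def leftFace : E × Bool → G.Face := G.dual.vert

theorem leftFace_facePerm (h : E × Bool) : G.leftFace (G.facePerm h) = G.leftFace h :=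
  G.dual.vert_rot h

theorem twin_twin (h : E × Bool) : twin (twin h) = h := by
  simp [twin]

theorem facePerm_twin (h : E × Bool) : G.facePerm (twin h) = G.rot⁻¹ h := by
  rw [facePerm, Equiv.Perm.mul_apply, twin_twin]

theorem rot_facePerm (h : E × Bool) : G.rot (G.facePerm h) = twin h := by
  simp [facePerm]

theorem leftFace_twin (h : E × Bool) : G.leftFace (twin h) = G.leftFace (G.rot⁻¹ h) := by
  rw [← G.leftFace_facePerm, facePerm_twin]

theorem vert_facePerm (h : E × Bool) : G.vert (G.facePerm h) = G.vert (twin h) := by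
  rw [← G.vert_rot, rot_facePerm]

theorem coboundary_vert (a : V → ZMod 2) (h : E × Bool) :
    coboundary G.vert a h.1 = a (G.vert h) + a (G.vert (G.facePerm h)) := by
  rw [vert_facePerm, coboundary_apply]

theorem coboundary_leftFace (b : G.Face → ZMod 2) (h : E × Bool) :
    coboundary G.leftFace b (G.rot h).1 = b (G.leftFace h) + b (G.leftFace (G.rot h)) := by
  rw [coboundary_apply, leftFace_twin, inv_rot_rot, add_comm]

variable {G}

/-- Connectedness makes the group generated by `rot` and `twin` transitive on half-edges: `rot`
moves around a vertex and `twin` along an edge. -/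
theorem eq_of_rot_of_twin [Nonempty E] (hG : G.Connected) {α : Type*} {p : E × Bool → α}
    (hrot : ∀ h, p (G.rot h) = p h) (htwin : ∀ h, p (twin h) = p h) (h k : E × Bool) :
    p h = p k := by
  have hvert : ∀ h k, G.vert h = G.vert k → p h = p k := by
    intro h k hk
    obtain ⟨i, rfl⟩ := (G.sameCycle_iff h k).2 hk
    clear hk
    induction i with
    | zero => rfl
    | succ i ih => rw [add_comm, zpow_add, Equiv.Perm.mul_apply, zpow_one, hrot, ih]
    | pred i ih =>
      rw [ih, ← hrot ((G.rot ^ (-(i : ℤ) - 1)) h), ← Equiv.Perm.mul_apply, ← zpow_one_add]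
      congr 3; ring
  have key : ∀ x y, (SimpleGraph.fromRel G.Joined).Walk x y → ∀ h k, G.vert h = x → G.vert k = y →
      p h = p k := by
    intro x y w
    induction w with
    | nil => intro h k hh hk; exact hvert h k (hh.trans hk.symm)
    | cons hadj _ ih =>
      intro h k hh hk
      obtain ⟨-, ⟨l, hl1, hl2⟩ | ⟨l, hl1, hl2⟩⟩ := (SimpleGraph.fromRel_adj _ _ _).1 hadj
      · exact (hvert h l (hh.trans hl1.symm)).trans ((htwin l).symm.trans (ih _ k hl2 hk))
      · exact (hvert h _ (hh.trans hl2.symm)).trans ((htwin l).trans (ih _ k hl1 hk))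
  obtain ⟨w⟩ := hG.preconnected (G.vert h) (G.vert k)
  exact key _ _ w h k rfl rfl

theorem eq_of_rot_of_facePerm [Nonempty E] (hG : G.Connected) {α : Type*} {p : E × Bool → α}
    (hrot : ∀ h, p (G.rot h) = p h) (hface : ∀ h, p (G.facePerm h) = p h) (h k : E × Bool) :
    p h = p k :=
  eq_of_rot_of_twin hG hrot (fun h => by rw [← G.rot_facePerm, hrot, hface]) h k

theorem leftFace_surjective [Nonempty E] (hG : G.Connected) :
    Function.Surjective G.leftFace := by
  rintro (q | v)
  · induction q using Quotient.inductionOn with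
    | h a => exact ⟨a, rfl⟩
  · obtain ⟨h, hh⟩ := G.vert_surjective hG v.1
    exact absurd hh (v.2 h)

theorem coboundary_vert_eq_zero_iff [Nonempty E] (hG : G.Connected) (a : V → ZMod 2) :
    coboundary G.vert a = 0 ↔ ∀ v w, a v = a w := by
  refine ⟨fun ha v w => ?_, coboundary_of_const _⟩
  obtain ⟨h, rfl⟩ := G.vert_surjective hG v
  obtain ⟨k, rfl⟩ := G.vert_surjective hG w
  refine eq_of_rot_of_twin hG (p := fun h => a (G.vert h)) (fun h => by rw [vert_rot])
    (fun h => ?_) h k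
  have := coboundary_apply G.vert a h
  rw [ha] at this
  exact (CharTwo.add_eq_zero.1 this.symm).symm

theorem coboundary_leftFace_eq_zero_iff [Nonempty E] (hG : G.Connected) (b : G.Face → ZMod 2) :
    coboundary G.leftFace b = 0 ↔ ∀ v w, b v = b w := by
  refine ⟨fun hb v w => ?_, coboundary_of_const _⟩
  obtain ⟨h, rfl⟩ := leftFace_surjective hG v
  obtain ⟨k, rfl⟩ := leftFace_surjective hG w
  refine eq_of_rot_of_facePerm hG (p := fun h => b (G.leftFace h)) (fun h => ?_)
    (fun h => by rw [leftFace_facePerm]) h k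
  have := G.coboundary_leftFace b h
  rw [hb] at this
  exact (CharTwo.add_eq_zero.1 this.symm).symm

/-- The sum of `x` over the half-edges at a vertex telescopes: each value of `κ` occurs twice in the
rotation. -/
theorem dotProduct_coboundary_vert [Fintype E] {x : E → ZMod 2} {κ : E × Bool → ZMod 2}
    (hx : ∀ h, x h.1 = κ h + κ (G.rot⁻¹ h)) (a : V → ZMod 2) :
    x ⬝ᵥ coboundary G.vert a = 0 := by
  rw [dotProduct_coboundary]
  simp only [hx, add_mul, Finset.sum_add_distrib]
  rw [CharTwo.add_eq_zero, ← Equiv.sum_comp G.rot (fun h => κ (G.rot⁻¹ h) * a (G.vert h))]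
  simp [vert_rot]

theorem dotProduct_coboundary_leftFace [Fintype E] {x : E → ZMod 2} {κ : E × Bool → ZMod 2}
    (hx : ∀ h, x h.1 = κ h + κ (G.facePerm h)) (b : G.Face → ZMod 2) :
    x ⬝ᵥ coboundary G.leftFace b = 0 := by
  rw [dotProduct_coboundary]
  simp only [hx, add_mul, Finset.sum_add_distrib]
  rw [CharTwo.add_eq_zero, ← Equiv.sum_comp G.facePerm (fun h => κ h * b (G.leftFace h))]
  simp [leftFace_facePerm]

/-- A face boundary is a closed walk, so it meets every cut evenly. Planarity is not needed. -/
theorem coboundary_dotProduct_coboundary [Fintype E] (a : V → ZMod 2) (b : G.Face → ZMod 2) :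
    coboundary G.vert a ⬝ᵥ coboundary G.leftFace b = 0 :=
  dotProduct_coboundary_leftFace (κ := fun h => a (G.vert h)) (fun h => G.coboundary_vert a h) b

open Classical in
-- Pairing with `a` isolates the effect of the loop convention: the sum on the right is the
-- deviation from the mod 2 boundary, in which the two ends of a loop cancel.
theorem dotProduct_incidence_mulVec [Fintype V] [Fintype E] (x : E → ZMod 2) (a : V → ZMod 2) :
    a ⬝ᵥ G.incidence.mulVec x = x ⬝ᵥ coboundary G.vert a +
      ∑ e, if G.vert (e, false) = G.vert (e, true) then x e * a (G.vert (e, false)) else 0 := by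
  rw [Matrix.dotProduct_mulVec, dotProduct_comm, dotProduct, dotProduct, ← Finset.sum_add_distrib]
  refine Finset.sum_congr rfl fun e _ => ?_
  have h1 : Matrix.vecMul a G.incidence e = ∑ v, if ∃ s, G.vert (e, s) = v then a v else 0 := by
    simp [Matrix.vecMul, dotProduct, incidence]
  rw [h1]
  split_ifs with he
  · rw [coboundary_of_loop he, mul_zero, zero_add]
    congr 1
    rw [Fintype.sum_eq_single (G.vert (e, false))]
    · rw [if_pos ⟨_, rfl⟩]
    · rintro v hv
      rw [if_neg]
      rintro ⟨_ | _, rfl⟩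
      · exact hv rfl
      · exact hv he.symm
  · rw [add_zero]
    congr 1
    have h2 : ∀ v, (if ∃ s, G.vert (e, s) = v then a v else 0) =
        (if G.vert (e, false) = v then a v else 0) + if G.vert (e, true) = v then a v else 0 := by
      intro v
      by_cases h3 : G.vert (e, false) = v
      · rw [if_pos ⟨_, h3⟩, if_pos h3, if_neg (fun h4 => he (h3.trans h4.symm)), add_zero]
      · by_cases h4 : G.vert (e, true) = v
        · rw [if_pos ⟨_, h4⟩, if_neg h3, if_pos h4, zero_add]
        · rw [if_neg h3, if_neg h4, if_neg, add_zero]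
          rintro ⟨_ | _, h5⟩
          · exact h3 h5
          · exact h4 h5
    simp only [h2, Finset.sum_add_distrib, Finset.sum_ite_eq, Finset.mem_univ, if_true]
    rfl

open Classical in
theorem incidence_mulVec_eq_zero_iff [Fintype V] [Fintype E]
    (x : E → ZMod 2) :
    G.incidence.mulVec x = 0 ↔ ∀ a : V → ZMod 2, x ⬝ᵥ coboundary G.vert a +
      ∑ e, (if G.vert (e, false) = G.vert (e, true) then x e * a (G.vert (e, false)) else 0)
        = 0 := by
  simp only [← dotProduct_incidence_mulVec]
  exact ⟨fun h a => by rw [h, dotProduct_zero],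
    fun h => dotProduct_eq_zero _ fun a => by rw [dotProduct_comm, h]⟩

/-! ### Plane graphs: duality of cuts and the bicycle space -/

section Plane

variable [Fintype V] [Fintype E] [Nonempty E]

instance : Finite G.Face := by
  have : Finite (Quotient (Equiv.Perm.SameCycle.setoid G.facePerm)) := Quotient.finite _
  exact Finite.instSum

/-- The dimensions are `v - 1` and `f - 1`, and Euler's formula gives the sum. This is where the
genus enters. -/
theorem finrank_range_coboundary (hG : G.IsPlane) :
    Module.finrank (ZMod 2) (LinearMap.range (coboundary G.vert)) +
      Module.finrank (ZMod 2) (LinearMap.range (coboundary G.leftFace)) = Fintype.card E := by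
  have := Fintype.ofFinite G.Face
  have : Nonempty V := hG.1.nonempty
  have : Nonempty G.Face := .map G.leftFace inferInstance
  have h1 := finrank_range_add_one _ (coboundary_vert_eq_zero_iff hG.1)
  have h2 := finrank_range_add_one _ (coboundary_leftFace_eq_zero_iff hG.1)
  have h3 := hG.2
  simp only [Nat.card_eq_fintype_card] at h3
  omega

theorem mem_range_coboundary_vert (hG : G.IsPlane) {x : E → ZMod 2}
    (hx : ∀ b, x ⬝ᵥ coboundary G.leftFace b = 0) :
    x ∈ LinearMap.range (coboundary G.vert) := by
  refine mem_of_dotProduct_eq_zero ?_ (finrank_range_coboundary hG) ?_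
  · rintro _ ⟨a, rfl⟩ _ ⟨b, rfl⟩
    exact coboundary_dotProduct_coboundary a b
  · rintro _ ⟨b, rfl⟩
    exact hx b

theorem mem_range_coboundary_leftFace (hG : G.IsPlane) {x : E → ZMod 2}
    (hx : ∀ a, x ⬝ᵥ coboundary G.vert a = 0) :
    x ∈ LinearMap.range (coboundary G.leftFace) := by
  refine mem_of_dotProduct_eq_zero ?_ ((add_comm _ _).trans (finrank_range_coboundary hG)) ?_
  · rintro _ ⟨b, rfl⟩ _ ⟨a, rfl⟩
    rw [dotProduct_comm]
    exact coboundary_dotProduct_coboundary a b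
  · rintro _ ⟨b, rfl⟩
    exact hx b

variable (G) in
/-- The bicycle space of a plane graph: the cuts of the graph that are cuts of its dual. -/
def bicycle : Submodule (ZMod 2) (E → ZMod 2) :=
  LinearMap.range (coboundary G.vert) ⊓ LinearMap.range (coboundary G.leftFace)

/-- A dual loop is a bridge: its indicator is orthogonal to all cuts of the dual, hence is a cut. -/
theorem exists_coboundary_vert_eq_single [DecidableEq E] (hG : G.IsPlane) (h₀ : E × Bool) {e : E}
    (he : G.leftFace (e, false) = G.leftFace (e, true)) :
    ∃ a, coboundary G.vert a = Pi.single e 1 ∧ a (G.vert h₀) = 0 := by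
  obtain ⟨a, ha⟩ := mem_range_coboundary_vert hG (x := Pi.single e 1)
    (fun b => by rw [single_dotProduct, coboundary_of_loop he, mul_zero])
  -- Adding a constant keeps the coboundary and selects the side that avoids `h₀`.
  refine ⟨a + fun _ => a (G.vert h₀), ?_, CharTwo.add_eq_zero.2 rfl⟩
  rw [map_add, ha, coboundary_of_const _ (fun _ _ => rfl), add_zero]

/-- A combinatorial Jordan curve theorem: a loop separates the faces into two sides. -/
theorem exists_coboundary_leftFace_eq_single [DecidableEq E] (hG : G.IsPlane) (h₀ : E × Bool)
    {e : E} (he : G.vert (e, false) = G.vert (e, true)) :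
    ∃ b, coboundary G.leftFace b = Pi.single e 1 ∧ b (G.leftFace h₀) = 0 := by
  obtain ⟨b, hb⟩ := mem_range_coboundary_leftFace hG (x := Pi.single e 1)
    (fun a => by rw [single_dotProduct, coboundary_of_loop he, mul_zero])
  refine ⟨b + fun _ => b (G.leftFace h₀), ?_, CharTwo.add_eq_zero.2 rfl⟩
  rw [map_add, hb, coboundary_of_const _ (fun _ _ => rfl), add_zero]

open Classical in
/-- A vector in the kernels of both incidence matrices vanishes on the loops of a plane graph and
on the loops of its dual. -/
theorem eq_zero_of_loop (hG : G.IsPlane) {x : E → ZMod 2}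
    (hv : G.incidence.mulVec x = 0) (hf : G.dual.incidence.mulVec x = 0) (e : E) :
    (G.vert (e, false) = G.vert (e, true) → x e = 0) ∧
      (G.leftFace (e, false) = G.leftFace (e, true) → x e = 0) := by
  let _ := Fintype.ofFinite G.Face
  rw [incidence_mulVec_eq_zero_iff] at hv hf
  have h₀ : E × Bool := Classical.arbitrary _
  -- Loops and dual loops are treated simultaneously, since the step for one kind uses the
  -- hypothesis for the other. The induction is on the number of half-edges on the side away from
  -- the base corner `h₀`.
  have key : ∀ n : ℕ,
      (∀ (e : E) (b : G.Face → ZMod 2), G.vert (e, false) = G.vert (e, true) →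
        coboundary G.leftFace b = Pi.single e 1 → b (G.leftFace h₀) = 0 →
        (Finset.univ.filter fun h => b (G.leftFace h) = 1).card < n → x e = 0) ∧
      (∀ (e : E) (a : V → ZMod 2), G.leftFace (e, false) = G.leftFace (e, true) →
        coboundary G.vert a = Pi.single e 1 → a (G.vert h₀) = 0 →
        (Finset.univ.filter fun h => a (G.vert h) = 1).card < n → x e = 0) := by
    intro n
    induction n with
    | zero => exact ⟨fun _ _ _ _ _ h => absurd h (Nat.not_lt_zero _),
        fun _ _ _ _ _ h => absurd h (Nat.not_lt_zero _)⟩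
    | succ n ih =>
      have hrot : Function.Surjective fun h : E × Bool => (G.rot h).1 :=
        Prod.fst_surjective.comp G.rot.surjective
      have hvert : ∀ h, ∃ s, G.vert h = G.vert ((G.rot h).1, s) :=
        fun h => ⟨(G.rot h).2, (G.vert_rot h).symm⟩
      constructor
      · intro e b he hb hb₀ hn
        exact eq_zero_of_loop_step (vert := G.vert) (face := G.leftFace) (σ := G.rot)
          (φ := G.facePerm) (p := Prod.fst) (q := fun h => (G.rot h).1)
          (fun _ => eq_of_rot_of_facePerm hG.1) G.vert_rot G.leftFace_facePerm G.coboundary_vert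
          G.coboundary_leftFace (fun h => ⟨h.2, rfl⟩) hvert hrot hf
          (fun _ => exists_coboundary_vert_eq_single hG h₀) ih.2 he hb hb₀ hn
      · intro e b he hb hb₀ hn
        exact eq_zero_of_loop_step (vert := G.leftFace) (face := G.vert) (σ := G.facePerm)
          (φ := G.rot) (p := fun h => (G.rot h).1) (q := Prod.fst)
          (fun _ h1 h2 => eq_of_rot_of_facePerm hG.1 h2 h1) G.leftFace_facePerm G.vert_rot
          G.coboundary_leftFace G.coboundary_vert hvert (fun h => ⟨h.2, rfl⟩)
          Prod.fst_surjective hv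
          (fun _ => exists_coboundary_leftFace_eq_single hG h₀) ih.1 he hb hb₀ hn
  constructor
  · intro he
    obtain ⟨b, hb, hb₀⟩ := exists_coboundary_leftFace_eq_single hG h₀ he
    exact (key _).1 e b he hb hb₀ (Nat.lt_succ_self _)
  · intro he
    obtain ⟨a, ha, ha₀⟩ := exists_coboundary_vert_eq_single hG h₀ he
    exact (key _).2 e a he ha ha₀ (Nat.lt_succ_self _)

theorem mem_bicycle_iff (hG : G.IsPlane) (x : E → ZMod 2) :
    x ∈ G.bicycle ↔ G.incidence.mulVec x = 0 ∧ G.dual.incidence.mulVec x = 0 := by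
  classical
  let _ := Fintype.ofFinite G.Face
  constructor
  · rintro ⟨⟨a, ha⟩, ⟨b, hb⟩⟩
    -- A coboundary vanishes on loops, so for a bicycle the correction terms vanish and only
    -- orthogonality remains.
    rw [incidence_mulVec_eq_zero_iff, incidence_mulVec_eq_zero_iff]
    constructor
    · intro a'
      rw [Finset.sum_eq_zero, add_zero, ← hb, dotProduct_comm]
      · exact coboundary_dotProduct_coboundary a' b
      · intro e _
        split_ifs with he
        · rw [← ha, coboundary_of_loop he, zero_mul]
        · rfl
    · intro b'
      rw [Finset.sum_eq_zero, add_zero, ← ha]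
      · exact coboundary_dotProduct_coboundary a b'
      · intro e _
        split_ifs with he
        · rw [← hb]
          exact mul_eq_zero_of_left (coboundary_of_loop (u := G.leftFace) he b) _
        · rfl
  · rintro ⟨hv, hf⟩
    have h := eq_zero_of_loop hG hv hf
    rw [incidence_mulVec_eq_zero_iff] at hv hf
    constructor
    · refine mem_range_coboundary_vert hG fun b => ?_
      have := hf b
      rwa [Finset.sum_eq_zero, add_zero] at this
      intro e _
      split_ifs with he
      · rw [(h e).2 he, zero_mul]
      · rfl
    · refine mem_range_coboundary_leftFace hG fun a => ?_
      have := hv a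
      rwa [Finset.sum_eq_zero, add_zero] at this
      intro e _
      split_ifs with he
      · rw [(h e).1 he, zero_mul]
      · rfl

end Plane

end EmbeddedGraph

/-! ### Component colourings as bicycles, and the rank -/

namespace SignedPlaneGraph

variable {V E : Type*} [Fintype V] [Fintype E] (G : SignedPlaneGraph V E)

/-- A colouring of the components of the diagram determines the set of those crossings where
components of different colours meet. -/
noncomputable def crossingMap :
    (Quot G.diagram.Follows → ZMod 2) →ₗ[ZMod 2] (E → ZMod 2) where
  toFun κ e := κ (Quot.mk _ (e, false)) + κ (Quot.mk _ (G.rot⁻¹ (e, false)))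
  map_add' a b := by ext e; simp only [Pi.add_apply]; ring
  map_smul' c a := by ext e; simp [mul_add]

/-- The arc in corner `a` ends at two crossings, on the edges of `a` and of `G.rot a`; the two
alternatives are its continuations through them. -/
theorem follows_iff (a b : E × Bool) :
    G.diagram.Follows a b ↔ b = twin a ∨ b = G.rot⁻¹ (twin (G.rot a)) := by
  constructor
  · rintro ⟨⟨h, _ | _⟩, rfl, rfl⟩
    · left; simp [diagram, EmbeddedGraph.medial, EmbeddedGraph.medialRot]
    · right; simp [diagram, EmbeddedGraph.medial, EmbeddedGraph.medialRot]
  · rintro (rfl | rfl)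
    · exact ⟨(a, false), rfl, by
        simp [diagram, EmbeddedGraph.medial, EmbeddedGraph.medialRot]⟩
    · exact ⟨(a, true), rfl, by
        simp [diagram, EmbeddedGraph.medial, EmbeddedGraph.medialRot]⟩

theorem quot_twin (h : E × Bool) :
    Quot.mk G.diagram.Follows (twin h) = Quot.mk _ h :=
  (Quot.sound ((G.follows_iff _ _).2 (Or.inl rfl))).symm

theorem quot_facePerm (h : E × Bool) :
    Quot.mk G.diagram.Follows (G.facePerm h) = Quot.mk _ (G.rot⁻¹ h) :=
  (Quot.sound ((G.follows_iff _ _).2 (Or.inr (by simp [EmbeddedGraph.facePerm])))).symm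

/-- The definition uses the half `(e, false)`; the other half gives the same value because opposite
half-arcs at the crossing lie on one component. -/
theorem crossingMap_eq_rot (κ : Quot G.diagram.Follows → ZMod 2) (h : E × Bool) :
    G.crossingMap κ h.1 = κ (Quot.mk _ h) + κ (Quot.mk _ (G.rot⁻¹ h)) := by
  obtain ⟨e, _ | _⟩ := h
  · rfl
  · have h1 := G.quot_twin (e, false)
    have h2 := G.quot_facePerm (e, false)
    change Quot.mk G.diagram.Follows (e, true) = _ at h1
    change Quot.mk G.diagram.Follows (G.rot⁻¹ (e, true)) = _ at h2
    rw [h1, h2]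
    rfl

theorem crossingMap_eq_facePerm (κ : Quot G.diagram.Follows → ZMod 2) (h : E × Bool) :
    G.crossingMap κ h.1 = κ (Quot.mk _ h) + κ (Quot.mk _ (G.facePerm h)) := by
  rw [quot_facePerm, crossingMap_eq_rot]

theorem crossingMap_eq_zero_iff [Nonempty E] (κ : Quot G.diagram.Follows → ZMod 2) :
    G.crossingMap κ = 0 ↔ ∀ v w, κ v = κ w := by
  constructor
  · rintro h ⟨v⟩ ⟨w⟩
    refine EmbeddedGraph.eq_of_rot_of_twin (G := G.toEmbeddedGraph) G.isPlane.1
      (p := fun h => κ (Quot.mk _ h)) (fun k => ?_) (fun k => by rw [quot_twin]) v w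
    have := G.crossingMap_eq_rot κ (G.rot k)
    rw [h, EmbeddedGraph.inv_rot_rot] at this
    exact CharTwo.add_eq_zero.1 this.symm
  · intro h
    ext e
    exact CharTwo.add_eq_zero.2 (h _ _)

theorem range_crossingMap [Nonempty E] : LinearMap.range G.crossingMap = G.bicycle := by
  apply le_antisymm
  · rintro _ ⟨κ, rfl⟩
    exact ⟨EmbeddedGraph.mem_range_coboundary_vert G.isPlane
        (EmbeddedGraph.dotProduct_coboundary_leftFace (G.crossingMap_eq_facePerm κ)),
      EmbeddedGraph.mem_range_coboundary_leftFace G.isPlane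
        (EmbeddedGraph.dotProduct_coboundary_vert (G.crossingMap_eq_rot κ))⟩
  · rintro x ⟨⟨a, ha⟩, ⟨b, hb⟩⟩
    -- Going straight through the crossing, from corner `h` to corner `twin h`, changes both the
    -- vertex and the face, each contributing `x h.1`. Going to corner `G.rot⁻¹ h`, on the other
    -- strand, keeps the vertex and changes only the face.
    have hv : ∀ h : E × Bool, a (G.vert (twin h)) = a (G.vert h) + x h.1 := by
      intro h
      rw [← ha, coboundary_apply, CharTwo.add_cancel_left]
    have hf : ∀ h : E × Bool, b (G.leftFace (twin h)) = b (G.leftFace h) + x h.1 := by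
      intro h
      rw [← hb, coboundary_apply, CharTwo.add_cancel_left]
    have twin_eq : ∀ h, a (G.vert (twin h)) + b (G.leftFace (twin h)) =
        a (G.vert h) + b (G.leftFace h) := by
      intro h
      rw [hv, hf, add_add_add_comm, CharTwo.add_self_eq_zero, add_zero]
    have rot_eq : ∀ h, a (G.vert (G.rot⁻¹ h)) + b (G.leftFace (G.rot⁻¹ h)) =
        a (G.vert h) + b (G.leftFace h) + x h.1 := by
      intro h
      rw [← G.leftFace_twin, hf, ← G.vert_rot, EmbeddedGraph.rot_inv_rot, add_assoc]
    refine ⟨Quot.lift (fun h => a (G.vert h) + b (G.leftFace h)) ?_, ?_⟩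
    · intro h k hk
      obtain rfl | rfl := (G.follows_iff h k).1 hk
      · exact (twin_eq h).symm
      · have h1 := rot_eq (G.rot h)
        rw [EmbeddedGraph.inv_rot_rot] at h1
        rw [h1, rot_eq, twin_eq]
        rfl
    · ext e
      change a (G.vert (e, false)) + b (G.leftFace (e, false)) +
        (a (G.vert (G.rot⁻¹ (e, false))) + b (G.leftFace (G.rot⁻¹ (e, false)))) = x e
      rw [rot_eq, CharTwo.add_cancel_left]

theorem ker_regionMatrix [Nonempty E] :
    LinearMap.ker G.regionMatrix.mulVecLin = G.bicycle := by
  ext x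
  rw [LinearMap.mem_ker, Matrix.mulVecLin_apply, regionMatrix, Matrix.fromRows_mulVec,
    EmbeddedGraph.mem_bicycle_iff G.isPlane]
  constructor
  · intro h
    exact ⟨funext fun v => congrFun h (Sum.inl v), funext fun f => congrFun h (Sum.inr f)⟩
  · rintro ⟨h1, h2⟩
    rw [h1, h2]
    ext (_ | _) <;> rfl

theorem rank_regionMatrix_add_numComponents :
    G.regionMatrix.rank + G.diagram.numComponents = Fintype.card E + 1 := by
  rcases isEmpty_or_nonempty E with hE | hE
  -- Without edges there is no arc to colour: the single component is the crossingless circle, and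
  -- the matrix has no columns.
  · have h1 : G.diagram.numComponents = 1 := by
      have h2 : IsEmpty (Quot G.diagram.Follows) := ⟨by rintro ⟨h⟩; exact isEmptyElim h⟩
      rw [LinkDiagram.numComponents, Nat.card_of_isEmpty, zero_add]
      exact G.card_isolated_of_isEmpty G.isPlane.1
    have h3 := Matrix.rank_le_card_width G.regionMatrix
    rw [Fintype.card_eq_zero] at h3 ⊢
    omega
  · have : Finite (Quot G.diagram.Follows) := Quot.finite _
    let _ := Fintype.ofFinite (Quot G.diagram.Follows)
    have : Nonempty (Quot G.diagram.Follows) := .map (Quot.mk _) inferInstance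
    have h1 : G.diagram.numComponents = Fintype.card (Quot G.diagram.Follows) := by
      rw [LinkDiagram.numComponents, Nat.card_eq_fintype_card]
      exact congrArg _ (G.card_isolated_of_nonempty G.isPlane.1)
    have h2 := finrank_range_add_one _ G.crossingMap_eq_zero_iff
    have h3 := G.regionMatrix.mulVecLin.finrank_range_add_finrank_ker
    rw [ker_regionMatrix, ← range_crossingMap, Module.finrank_fintype_fun_eq_card] at h3
    rw [Matrix.rank]
    omega

end SignedPlaneGraph

/-- The equation is stated in `ℤ` because `c - n + 1` is negative for `n > c + 1`. -/
theorem theorem1p4 {V E : Type*} [Fintype V] [Fintype E] (G : SignedPlaneGraph V E) (n : ℕ) :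
    G.diagram.numComponents = n ↔
      (G.regionMatrix.rank : ℤ) = (Fintype.card E : ℤ) - (n : ℤ) + 1 := by
  have := G.rank_regionMatrix_add_numComponents
  omega
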